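/- Let $V$ be a commutative valuation domain (of arbitrary Krull dimension) with field of quotients $F$, let $K/F$ be a finite Galois extension with group $G$, and let $S$ be the integral closure of $V$ in $K$. Let $f\colon G\times G\to K^{\times}$ be a normalized two-cocycle (that is, $f(\sigma,\tau)f(\sigma\tau,\gamma)=\sigma(f(\tau,\gamma))f(\sigma,\tau\gamma)$ and $f(1,\sigma)=f(\sigma,1)=1$ for all $\sigma,\tau,\gamma\in G$) all of whose values lie in $S$; the values need not be units of $S$. Let $A_f=\bigoplus_{\sigma\in G}Sx_\sigma$ be the $G$-graded ring that is free as a left $S$-module on the symbols $x_\sigma$, with multiplication $(sx_\sigma)(tx_\tau)=s\,\sigma(t)f(\sigma,\tau)x_{\sigma\tau}$ for $s,t\in S$, $\sigma,\tau\in G$. Let $J(A_f)$ be the Jacobson radical of $A_f$ and let $J_G(A_f)$ be its graded Jacobson radical, the intersection of all maximal graded left ideals of $A_f$. For $\sigma\in G$ let $I_\sigma$ be the intersection of those maximal ideals $N$ of $S$ for which $f(\sigma,\sigma^{-1})\notin N$ (so $I_\sigma=S$ if there are none). Fix a maximal ideal $M$ of $S$, let $\overline V$ and $\overline S_M$ be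 the residue fields of $V$ and of the localization $S_M$, and let $e=[\Gamma_{S_M}:\Gamma_V]$ be the ramification index, where $\Gamma_V=F^\times/V^\times$ and $\Gamma_{S_M}=K^\times/S_M^\times$ are the value groups. Suppose that $K/F$ is tamely ramified, i.e. $\operatorname{char}\overline V$ does not divide $e$ and $\overline S_M/\overline V$ is separable, and that $K/F$ is defectless, i.e. $[K:F]=e\,[\overline S_M:\overline V]\,r$, where $r$ is the number of maximal ideals of $S$. Then $$J(A_f)=J_G(A_f)=\sum_{\sigma\in G}I_\sigma x_\sigma .$$ -/

import Mathlib

/-! ### Weak crossed products -/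

/-- A normalized two-cocycle of a group `G` with values in a commutative ring `R` on which `G`
acts. The values need not be units of `R`. -/
structure NormalizedCocycle (G R : Type*) [Group G] [CommRing R] [MulSemiringAction G R] where
  /-- the value `f(σ, τ)` -/
  val : G → G → R
  cocycle : ∀ g h j : G, val (g * h) j * val g h = g • val h j * val g (h * j)
  one_left : ∀ g : G, val 1 g = 1
  one_right : ∀ g : G, val g 1 = 1

/-- The crossed product `∑_{σ ∈ G} R x_σ`: the free left `R`-module on symbols `x_σ`, `σ ∈ G`;
`a.coeff σ` is the coefficient of `x_σ` in `a`. -/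
@[ext]
structure CrossedProduct {G R : Type*} [Group G] [CommRing R] [MulSemiringAction G R]
    (f : NormalizedCocycle G R) where
  /-- the coefficient of `x_σ` -/
  coeff : G → R

namespace CrossedProduct

variable {G R : Type*} [Group G] [CommRing R] [MulSemiringAction G R]
  {f : NormalizedCocycle G R}

instance : Zero (CrossedProduct f) := ⟨⟨0⟩⟩
instance : Add (CrossedProduct f) := ⟨fun a b => ⟨a.coeff + b.coeff⟩⟩
instance : Neg (CrossedProduct f) := ⟨fun a => ⟨-a.coeff⟩⟩

@[simp] theorem coeff_zero (g : G) : (0 : CrossedProduct f).coeff g = 0 := rfl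
@[simp] theorem coeff_add (a b : CrossedProduct f) (g : G) :
    (a + b).coeff g = a.coeff g + b.coeff g := rfl
@[simp] theorem coeff_neg (a : CrossedProduct f) (g : G) : (-a).coeff g = -a.coeff g := rfl

instance : AddCommGroup (CrossedProduct f) where
  add_assoc a b c := by ext; simp [add_assoc]
  zero_add a := by ext; simp
  add_zero a := by ext; simp
  add_comm a b := by ext; simp [add_comm]
  neg_add_cancel a := by ext; simp
  nsmul := nsmulRec
  zsmul := zsmulRec

/-- The left `R`-module structure, coefficient by coefficient. -/
instance : Module R (CrossedProduct f) where
  smul r a := ⟨fun g => r * a.coeff g⟩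
  one_smul a := by ext g; exact one_mul _
  mul_smul r s a := by ext g; exact mul_assoc _ _ _
  smul_zero r := by ext g; exact mul_zero _
  smul_add r a b := by ext g; exact mul_add _ _ _
  add_smul r s a := by ext g; exact add_mul _ _ _
  zero_smul a := by ext g; exact zero_mul _

@[simp] theorem coeff_smul (r : R) (a : CrossedProduct f) (g : G) :
    (r • a).coeff g = r * a.coeff g := rfl

open scoped Classical in
/-- The basis element `x_σ`. -/
noncomputable def x (f : NormalizedCocycle G R) (σ : G) : CrossedProduct f :=
  ⟨fun g => if g = σ then 1 else 0⟩

open scoped Classical in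
theorem coeff_x (σ g : G) : (x f σ).coeff g = if g = σ then 1 else 0 := rfl

noncomputable instance : One (CrossedProduct f) := ⟨x f 1⟩

theorem one_def : (1 : CrossedProduct f) = x f 1 := rfl

variable [Fintype G]

/-- The multiplication with `(s x_σ)(t x_τ) = s σ(t) f(σ,τ) x_{στ}`: the coefficient of `x_ρ` in
`a b` collects the pairs `(σ, σ⁻¹ρ)`. -/
instance : Mul (CrossedProduct f) :=
  ⟨fun a b => ⟨fun ρ => ∑ σ : G,
    a.coeff σ * σ • b.coeff (σ⁻¹ * ρ) * f.val σ (σ⁻¹ * ρ)⟩⟩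

theorem coeff_mul (a b : CrossedProduct f) (ρ : G) :
    (a * b).coeff ρ =
      ∑ σ : G, a.coeff σ * σ • b.coeff (σ⁻¹ * ρ) * f.val σ (σ⁻¹ * ρ) := rfl

theorem mul_assoc_aux (a b c : CrossedProduct f) : a * b * c = a * (b * c) := by
  ext ρ
  simp only [coeff_mul, Finset.sum_mul, Finset.mul_sum, Finset.smul_sum, smul_mul']
  rw [Finset.sum_comm]
  refine Finset.sum_congr rfl fun τ _ => ?_
  refine (Fintype.sum_equiv (Equiv.mulLeft τ) _ _ fun μ => ?_).symm
  have h := f.cocycle τ μ (μ⁻¹ * (τ⁻¹ * ρ))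
  simp only [Equiv.coe_mulLeft, inv_mul_cancel_left, mul_inv_rev, mul_assoc,
    mul_inv_cancel_left, ← mul_smul] at h ⊢
  linear_combination (-(a.coeff τ * τ • b.coeff μ * (τ * μ) • c.coeff (μ⁻¹ * (τ⁻¹ * ρ)))) * h

noncomputable instance : Ring (CrossedProduct f) where
  left_distrib a b c := by
    ext ρ; simp [coeff_mul, mul_add, add_mul, Finset.sum_add_distrib]
  right_distrib a b c := by
    ext ρ; simp [coeff_mul, add_mul, Finset.sum_add_distrib]
  zero_mul a := by ext ρ; simp [coeff_mul]
  mul_zero a := by ext ρ; simp [coeff_mul]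
  mul_assoc := mul_assoc_aux
  one_mul a := by
    ext ρ
    rw [coeff_mul, Finset.sum_eq_single 1] <;> simp +contextual [one_def, coeff_x, f.one_left]
  mul_one a := by
    ext ρ
    rw [coeff_mul, Finset.sum_eq_single ρ]
    · simp [one_def, coeff_x, f.one_right]
    · intro σ _ hσ
      have : σ⁻¹ * ρ ≠ 1 := fun h => hσ (inv_mul_eq_one.mp h)
      simp [one_def, coeff_x, this]
    · simp
  neg_add_cancel := neg_add_cancel
  zsmul := zsmulRec

/-- The multiplication rule that determines the ring structure. -/
theorem smul_x_mul_smul_x (s t : R) (σ τ : G) :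
    (s • x f σ) * (t • x f τ) = (s * σ • t * f.val σ τ) • x f (σ * τ) := by
  ext ρ
  rw [coeff_mul, Finset.sum_eq_single σ]
  · by_cases h : ρ = σ * τ
    · subst h; simp [coeff_x]
    · have h' : σ⁻¹ * ρ ≠ τ := fun h' => h (by rw [← h', mul_inv_cancel_left])
      simp [coeff_x, h, h']
  · intro g _ hg
    simp [coeff_x, hg]
  · simp

/-- The degree `σ` component `R x_σ` of the `G`-grading. Mathlib writes the monoid that indexes a
grading additively, hence the index type `Additive G`; `G` need not be commutative. -/
noncomputable def component (f : NormalizedCocycle G R) (σ : Additive G) :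
    AddSubgroup (CrossedProduct f) where
  carrier := {a | ∃ s : R, a = s • x f σ.toMul}
  zero_mem' := ⟨0, by simp⟩
  add_mem' := by
    rintro _ _ ⟨s, rfl⟩ ⟨t, rfl⟩
    exact ⟨s + t, (add_smul _ _ _).symm⟩
  neg_mem' := by
    rintro _ ⟨s, rfl⟩
    exact ⟨-s, (neg_smul _ _).symm⟩

theorem coeff_sum {ι : Type*} (t : Finset ι) (u : ι → CrossedProduct f) (g : G) :
    (∑ i ∈ t, u i).coeff g = ∑ i ∈ t, (u i).coeff g := by
  classical
  induction t using Finset.induction_on with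
  | empty => simp
  | insert i t hi ih => rw [Finset.sum_insert hi, Finset.sum_insert hi, coeff_add, ih]

theorem sum_coeff_smul_x (a : CrossedProduct f) : ∑ σ : G, a.coeff σ • x f σ = a := by
  ext g
  simp only [coeff_sum, coeff_smul, coeff_x, mul_ite, mul_one, mul_zero]
  rw [Finset.sum_eq_single g] <;> simp +contextual [eq_comm]

/-- The map `a ↦ a_σ x_σ` that sends an element to its homogeneous component of degree `σ`. -/
noncomputable def toComponent (f : NormalizedCocycle G R) (σ : Additive G) :
    CrossedProduct f →+ component f σ where
  toFun a := ⟨a.coeff σ.toMul • x f σ.toMul, ⟨_, rfl⟩⟩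
  map_zero' := Subtype.ext (zero_smul _ _)
  map_add' _ _ := Subtype.ext (add_smul _ _ _)

theorem toComponent_of_mem (i j : Additive G) (y : component f i) [Decidable (j = i)] :
    toComponent f j y = if h : j = i then h ▸ y else 0 := by
  obtain ⟨_, s, rfl⟩ := y
  split_ifs with h
  · subst h
    refine Subtype.ext ?_
    ext g
    simp [toComponent, coeff_x]
  · refine Subtype.ext ?_
    ext g
    simp [toComponent, coeff_x, h]

open scoped Classical in
/-- `∑_{σ ∈ G} R x_σ` is a `G`-graded ring. -/
noncomputable instance : GradedRing (component f) where
  one_mem := ⟨1, by rw [one_smul]; rfl⟩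
  mul_mem := by
    rintro i j _ _ ⟨s, rfl⟩ ⟨t, rfl⟩
    exact ⟨_, smul_x_mul_smul_x s t i.toMul j.toMul⟩
  toDecomposition := DirectSum.Decomposition.ofAddHom (component f)
    (∑ σ : Additive G, (DirectSum.of (fun i => component f i) σ).comp (toComponent f σ))
    (by
      ext1 a
      simp only [AddMonoidHom.comp_apply, AddMonoidHom.finsetSum_apply, map_sum,
        DirectSum.coeAddMonoidHom_of]
      exact (Fintype.sum_equiv Additive.toMul _ (fun σ => a.coeff σ • x f σ) fun _ => rfl).trans
        (sum_coeff_smul_x a))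
    (by
      refine DirectSum.addHom_ext fun i y => ?_
      simp only [AddMonoidHom.comp_apply, AddMonoidHom.finsetSum_apply,
        DirectSum.coeAddMonoidHom_of, AddMonoidHom.id_apply]
      rw [Finset.sum_eq_single i]
      · rw [toComponent_of_mem, dif_pos rfl]
      · intro j _ hj
        rw [toComponent_of_mem, dif_neg hj, map_zero]
      · simp)

end CrossedProduct

/-! ### The graded Jacobson radical -/

/-- The graded Jacobson radical of a graded ring: the intersection of its maximal graded left
ideals, that is, of the maximal elements among the proper homogeneous left ideals. -/
def gradedJacobson {ι σ A : Type*} [Ring A] [SetLike σ A] [AddSubmonoidClass σ A]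
    [DecidableEq ι] [AddMonoid ι] (𝒜 : ι → σ) [GradedRing 𝒜] : HomogeneousIdeal 𝒜 :=
  sInf {m : HomogeneousIdeal 𝒜 | IsCoatom m}

open scoped Classical in
/-- The graded Jacobson radical `J_G` of the `G`-graded ring `∑_{σ ∈ G} R x_σ`, as a left ideal. -/
noncomputable def CrossedProduct.gradedRadical {G R : Type*} [Group G] [Fintype G] [CommRing R]
    [MulSemiringAction G R] (f : NormalizedCocycle G R) : Ideal (CrossedProduct f) :=
  (gradedJacobson (CrossedProduct.component f)).toIdeal

/-! ### Ramification of a valuation ring in an extension field -/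

section Ramification

variable {V K : Type*} [CommRing V] [Field K] [Algebra V K]

/-- A maximal ideal `M` of the integral closure `S` of `V` lies over the maximal ideal of `V`, so
`V → S_M` is a local homomorphism. -/
instance isLocalHom_localizationAtMaximal [IsLocalRing V] (M : Ideal (integralClosure V K)) [M.IsMaximal] :
    IsLocalHom (algebraMap V (Localization.AtPrime M)) where
  map_nonunit v hv := by
    have hM : (M.comap (algebraMap V (integralClosure V K))).IsMaximal :=
      Ideal.isMaximal_comap_of_isIntegral_of_isMaximal M
    by_contra h
    have hv' : v ∈ M.comap (algebraMap V (integralClosure V K)) := by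
      rw [IsLocalRing.eq_maximalIdeal hM]
      exact (IsLocalRing.mem_maximalIdeal v).mpr h
    rw [IsScalarTower.algebraMap_apply V (integralClosure V K) (Localization.AtPrime M),
      IsLocalization.AtPrime.isUnit_to_map_iff (Localization.AtPrime M) M] at hv
    exact hv hv'

/-- The embedding `S_M → K`, where `S` is the integral closure of `V` in `K`. -/
noncomputable def localizationToField (M : Ideal (integralClosure V K)) [M.IsPrime] :
    Localization.AtPrime M →+* K :=
  IsLocalization.lift (M := M.primeCompl) (g := algebraMap (integralClosure V K) K) fun s => by
    refine IsUnit.mk0 _ fun h => s.2 ?_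
    have : (s : integralClosure V K) = 0 := Subtype.ext h
    rw [this]
    exact M.zero_mem

theorem localizationToField_algebraMap (M : Ideal (integralClosure V K)) [M.IsPrime] (v : V) :
    localizationToField M (algebraMap V (Localization.AtPrime M) v) = algebraMap V K v := by
  rw [IsScalarTower.algebraMap_apply V (integralClosure V K) (Localization.AtPrime M),
    localizationToField, IsLocalization.lift_eq]
  rfl

/-- The value group `Γ_U = L^× / U^×` of a subring `U` of a field `L`, the inclusion being `i`. -/
abbrev ValueGroup {U L : Type*} [CommRing U] [Field L] (i : U →+* L) : Type _ :=
  Lˣ ⧸ (Units.map (i : U →* L)).range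

variable (F : Type*) [Field F] [Algebra V F] [Algebra F K] [IsScalarTower V F K]

/-- The natural homomorphism `Γ_V → Γ_{S_M}`. -/
noncomputable def valueGroupMap (M : Ideal (integralClosure V K)) [M.IsPrime] :
    ValueGroup (algebraMap V F) →* ValueGroup (localizationToField M) :=
  QuotientGroup.map _ _ (Units.map (algebraMap F K : F →* K)) (by
    rintro _ ⟨v, rfl⟩
    refine ⟨Units.map (algebraMap V (Localization.AtPrime M) : V →* _) v, Units.ext ?_⟩
    exact (localizationToField_algebraMap M v).trans (IsScalarTower.algebraMap_apply V F K _))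

/-- The ramification index `e(S_M | F) = [Γ_{S_M} : Γ_V]`. -/
noncomputable def ramificationIndex (M : Ideal (integralClosure V K)) [M.IsPrime] : ℕ :=
  (valueGroupMap F M).range.index

/-- `K/F` is tamely ramified (with respect to `V` and the maximal ideal `M` of the integral
closure): the residue characteristic does not divide the ramification index, and the residue field
extension is separable. -/
def IsTamelyRamified [IsLocalRing V] (M : Ideal (integralClosure V K)) [M.IsMaximal] : Prop :=
  ¬ ringChar (IsLocalRing.ResidueField V) ∣ ramificationIndex F M ∧
    Algebra.IsSeparable (IsLocalRing.ResidueField V)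
      (IsLocalRing.ResidueField (Localization.AtPrime M))

/-- `K/F` is defectless: `[K : F] = e f r`, with `e` the ramification index of `S_M` over `F`, `f`
the residue degree, and `r` the number of maximal ideals of `S`. -/
def IsDefectless [IsLocalRing V] (M : Ideal (integralClosure V K)) [M.IsMaximal] : Prop :=
  Module.finrank F K =
    ramificationIndex F M *
      Module.finrank (IsLocalRing.ResidueField V)
        (IsLocalRing.ResidueField (Localization.AtPrime M)) *
      Nat.card (MaximalSpectrum (integralClosure V K))

end Ramification

/-! ### The crossed-product order -/

section Order

variable {V F K : Type*} [CommRing V] [Field F] [Algebra V F] [Field K] [Algebra F K]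
  [Algebra V K] [IsScalarTower V F K]

/-- A normalized two-cocycle `f : G × G → K^×`, `G = Gal(K/F)`, with values in the integral closure
`S` of `V` in `K`, as a cocycle with values in `S`. -/
def integralCocycle (f : (K ≃ₐ[F] K) × (K ≃ₐ[F] K) → Kˣ)
    (hf : groupCohomology.IsMulCocycle₂ f)
    (hnorm : ∀ σ : K ≃ₐ[F] K, f (1, σ) = 1 ∧ f (σ, 1) = 1)
    (hint : ∀ σ τ : K ≃ₐ[F] K, (f (σ, τ) : K) ∈ integralClosure V K) :
    NormalizedCocycle (K ≃ₐ[F] K) (integralClosure V K) where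
  val σ τ := ⟨f (σ, τ), hint σ τ⟩
  cocycle g h j := Subtype.ext (congrArg Units.val (hf g h j))
  one_left g := Subtype.ext (congrArg Units.val (hnorm g).1)
  one_right g := Subtype.ext (congrArg Units.val (hnorm g).2)

end Order

/-- The ideal `I_σ`: the intersection of those maximal ideals `M` of `R` that do not contain
`f(σ, σ⁻¹)` (it is `R` if there are none). -/
def cocycleIdeal {G R : Type*} [Group G] [CommRing R] [MulSemiringAction G R]
    (f : NormalizedCocycle G R) (σ : G) : Ideal R :=
  sInf {M : Ideal R | M.IsMaximal ∧ f.val σ σ⁻¹ ∉ M}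

/-! ### The ideals $I_\sigma$ and the cocycle identities behind them -/

namespace CrossedProduct

variable {G R : Type*} [Group G] [CommRing R] [MulSemiringAction G R]
  {f : NormalizedCocycle G R}

/-! A graded left ideal is governed by its degree-one part: multiplying $a_\sigma x_\sigma$ by
$x_{\sigma^{-1}}$ lands in degree one. Hence the maximal graded left ideals correspond to the
maximal ideals of $S$, and their intersection is $\sum I_\sigma x_\sigma$ (`mem_gradedRadical_iff`).

$J_G\subseteq J$: modulo a maximal ideal $N$, the relation $f(\sigma,\sigma^{-1}\rho)\notin N$ is a
preorder on $G$, and each factor with coefficients in the $I_\sigma$ moves strictly up it. So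
$|G|$-th powers of elements of $J_G$ have coefficients in the Jacobson radical of $S$, and
Nakayama's lemma applies (`gradedRadical_le_jacobson`).

$J\subseteq J_G$: right multiplication by $x_{\sigma^{-1}}$ reduces this to $a_1\in N$ for every
$a\in J$ and every $N$. The regular representation modulo $M$ sends $J$ to nilpotent matrices, so
$\sum_\rho \rho(sa_1)\in M$ for all $s\in S$. Grouping equal characters $s\mapsto\rho(s)\bmod M$
gives coefficients equal to the order of the inertia group. That order is $e$ by defectlessness and
separability, hence invertible by tameness, and independence of characters gives $\rho(a_1)\in M$
for all $\rho$. -/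

theorem smul_val_self_inv (f : NormalizedCocycle G R) (σ : G) :
    σ⁻¹ • f.val σ σ⁻¹ = f.val σ⁻¹ σ := by
  have h := f.cocycle σ⁻¹ σ σ⁻¹
  simpa [f.one_left, f.one_right] using h.symm

/-- An element of `∑ R x_σ` is determined by its coefficients, `R`-linearly. -/
def coeffEquiv (f : NormalizedCocycle G R) : CrossedProduct f ≃ₗ[R] (G → R) where
  toFun := coeff
  invFun c := ⟨c⟩
  map_add' _ _ := rfl
  map_smul' _ _ := rfl
  left_inv _ := rfl
  right_inv _ := rfl

theorem smul_mem_of_forall_isMaximal {r : R} (hr : ∀ N : Ideal R, N.IsMaximal → r ∈ N) (σ : G)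
    (N : Ideal R) (hN : N.IsMaximal) : σ • r ∈ N :=
  hr _ (Ideal.comap_isMaximal_of_equiv (MulSemiringAction.toRingEquiv G R σ) (p := N))

/-- By primality only the $N$ avoiding $f(\sigma,\sigma^{-1})$ constrain $r$. In this form the
condition is membership in the Jacobson radical of $R$, which is stable under $G$. -/
theorem mem_cocycleIdeal_iff {σ : G} {r : R} :
    r ∈ cocycleIdeal f σ ↔ ∀ N : Ideal R, N.IsMaximal → r * f.val σ σ⁻¹ ∈ N := by
  simp only [cocycleIdeal, Submodule.mem_sInf, Set.mem_ofPred_eq, and_imp]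
  refine ⟨fun h N hN => ?_, fun h N hN hf => (hN.isPrime.mem_or_mem (h N hN)).resolve_right hf⟩
  by_cases hf : f.val σ σ⁻¹ ∈ N
  · exact N.mul_mem_left _ hf
  · exact N.mul_mem_right _ (h N hN hf)

variable [Fintype G]

instance : Module.Finite R (CrossedProduct f) := .equiv (coeffEquiv f).symm

instance : IsScalarTower R (CrossedProduct f) (CrossedProduct f) where
  smul_assoc r a b := by
    ext ρ
    simp [coeff_mul, Finset.mul_sum, mul_assoc]

theorem coeff_mul_x (a : CrossedProduct f) (σ τ : G) :
    (a * x f τ).coeff (σ * τ) = a.coeff σ * f.val σ τ := by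
  rw [coeff_mul, Finset.sum_eq_single σ]
  · simp [coeff_x]
  · intro g _ hg
    have : g⁻¹ * (σ * τ) ≠ τ := fun h => hg (by
      rw [inv_mul_eq_iff_eq_mul] at h; exact (mul_right_cancel h).symm)
    simp [coeff_x, this]
  · simp

/-! ### The regular representation -/

open scoped Classical in
/-- Left multiplication on `∑ x_σ R`, as a matrix over `R` in the right basis `x_σ`. -/
noncomputable def toMatrix (f : NormalizedCocycle G R) :
    CrossedProduct f →+* Matrix G G R where
  toFun a := .of fun ρ τ => ρ⁻¹ • (a.coeff (ρ * τ⁻¹) * f.val (ρ * τ⁻¹) τ)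
  map_one' := by
    ext ρ τ
    simp only [Matrix.of_apply, one_def, coeff_x, Matrix.one_apply, mul_inv_eq_one]
    split_ifs with h
    · subst h; simp [f.one_left]
    · simp
  map_zero' := by ext; simp
  map_add' a b := by ext; simp [add_mul]
  map_mul' a b := by
    ext ρ τ
    simp only [Matrix.of_apply, Matrix.mul_apply, coeff_mul, Finset.sum_mul, Finset.smul_sum]
    refine (Fintype.sum_equiv ((Equiv.inv G).trans (Equiv.mulLeft ρ)) _ _ fun μ => ?_).symm
    have h := f.cocycle (ρ * μ⁻¹) (μ * τ⁻¹) τ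
    simp only [Equiv.trans_apply, Equiv.inv_apply, Equiv.coe_mulLeft, mul_inv_rev, inv_inv,
      mul_assoc, inv_mul_cancel_left, inv_mul_cancel, mul_one] at h ⊢
    rw [mul_comm (f.val (ρ * μ⁻¹) (μ * τ⁻¹)), h]
    simp only [smul_mul', ← mul_smul, inv_mul_cancel_left]
    ring

theorem toMatrix_apply (a : CrossedProduct f) (ρ τ : G) :
    toMatrix f a ρ τ = ρ⁻¹ • (a.coeff (ρ * τ⁻¹) * f.val (ρ * τ⁻¹) τ) := rfl

/-- Diagonal entries see only the coefficient of $x_1$, and $f(1,\rho)=1$. -/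
theorem trace_toMatrix (a : CrossedProduct f) :
    (toMatrix f a).trace = ∑ ρ : G, ρ • a.coeff 1 := by
  rw [Matrix.trace]
  refine Fintype.sum_equiv (Equiv.inv G) _ _ fun ρ => ?_
  simp [toMatrix_apply, f.one_left]

open scoped Classical in
theorem toMatrix_smul_one (r : R) :
    toMatrix f (r • 1) = Matrix.diagonal fun ρ : G => ρ⁻¹ • r := by
  ext ρ τ
  rw [toMatrix_apply, Matrix.diagonal_apply, coeff_smul, one_def, coeff_x]
  simp only [mul_inv_eq_one]
  split_ifs with h
  · subst h; simp [f.one_left]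
  · simp

/-! ### The graded radical -/

open scoped Classical in
theorem coe_decompose (a : CrossedProduct f) (σ : Additive G) :
    (DirectSum.decompose (component f) a σ : CrossedProduct f) =
      a.coeff σ.toMul • x f σ.toMul := by
  conv_lhs => rw [← sum_coeff_smul_x a]
  rw [← DirectSum.decomposeAddEquiv_apply, map_sum, DFinsupp.finsetSum_apply,
    AddSubmonoidClass.coe_finsetSum, Finset.sum_eq_single σ.toMul]
  · exact DirectSum.decompose_of_mem_same _ ⟨_, rfl⟩
  · intro τ _ hτ
    exact DirectSum.decompose_of_mem_ne (i := Additive.ofMul τ) _ ⟨_, rfl⟩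
      fun h => hτ (congrArg Additive.toMul h)
  · simp

open scoped Classical in
/-- The largest graded left ideal whose component of degree `1` lies in the ideal `N` of `R`. -/
noncomputable def gradedIdealOver (f : NormalizedCocycle G R) (N : Ideal R) :
    HomogeneousIdeal (component f) where
  carrier := {a | ∀ σ, σ⁻¹ • a.coeff σ * f.val σ⁻¹ σ ∈ N}
  zero_mem' σ := by simp
  add_mem' ha hb σ := by
    rw [coeff_add, smul_add, add_mul]
    exact N.add_mem (ha σ) (hb σ)
  smul_mem' c a ha ρ := by
    rw [smul_eq_mul, coeff_mul, Finset.smul_sum, Finset.sum_mul]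
    refine N.sum_mem fun σ _ => ?_
    have h := f.cocycle ρ⁻¹ σ (σ⁻¹ * ρ)
    -- Associativity of $x_{\rho^{-1}}(c_\sigma x_\sigma)(a_\tau x_\tau)$ with
    -- $\tau=\sigma^{-1}\rho$: the degree-one test for $ca$ at $\rho$ is a multiple of the test for
    -- $a$ at $\tau$.
    have key : ρ⁻¹ • (c.coeff σ * σ • a.coeff (σ⁻¹ * ρ) * f.val σ (σ⁻¹ * ρ)) * f.val ρ⁻¹ ρ =
        ρ⁻¹ • c.coeff σ * f.val ρ⁻¹ σ *
          ((σ⁻¹ * ρ)⁻¹ • a.coeff (σ⁻¹ * ρ) * f.val (σ⁻¹ * ρ)⁻¹ (σ⁻¹ * ρ)) := by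
      simp only [smul_mul', ← mul_smul, mul_inv_rev, inv_inv, mul_inv_cancel_left] at h ⊢
      linear_combination (-(ρ⁻¹ • c.coeff σ * (ρ⁻¹ * σ) • a.coeff (σ⁻¹ * ρ))) * h
    rw [key]
    exact N.mul_mem_left _ (ha _)
  is_homogeneous' i a ha τ := by
    rw [coe_decompose, coeff_smul, coeff_x]
    split_ifs with h
    · rw [h]; simpa using ha (Additive.toMul i)
    · simp

theorem mem_gradedIdealOver {N : Ideal R} {a : CrossedProduct f} :
    a ∈ gradedIdealOver f N ↔ ∀ σ, σ⁻¹ • a.coeff σ * f.val σ⁻¹ σ ∈ N := Iff.rfl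

open scoped Classical in
theorem smul_one_mem_of_mem {Q : HomogeneousIdeal (component f)} {a : CrossedProduct f}
    (ha : a ∈ Q) (σ : G) :
    (σ⁻¹ • a.coeff σ * f.val σ⁻¹ σ) • (1 : CrossedProduct f) ∈ Q.toIdeal := by
  have h := Q.toIdeal.mul_mem_left (x f σ⁻¹) (Q.is_homogeneous' (Additive.ofMul σ) ha)
  rw [coe_decompose, ← one_smul R (x f σ⁻¹), smul_x_mul_smul_x] at h
  simpa [one_def] using h

theorem smul_one_mem_gradedIdealOver {N : Ideal R} {r : R} (hr : r ∈ N) :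
    r • (1 : CrossedProduct f) ∈ gradedIdealOver f N := fun σ => by
  rw [coeff_smul, one_def, coeff_x]
  split_ifs with h
  · subst h; simpa [f.one_left] using hr
  · simp

open scoped Classical in
theorem gradedIdealOver_ne_top {N : Ideal R} (hN : N ≠ ⊤) : gradedIdealOver f N ≠ ⊤ := by
  intro h
  have h1 : (1 : CrossedProduct f) ∈ gradedIdealOver f N := h ▸ Submodule.mem_top
  have := h1 1
  rw [one_def, coeff_x] at this
  exact hN ((Ideal.eq_top_iff_one N).mpr (by simpa [f.one_left] using this))

open scoped Classical in
theorem eq_top_of_one_mem {Q : HomogeneousIdeal (component f)}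
    (h : (1 : CrossedProduct f) ∈ Q.toIdeal) : Q = ⊤ :=
  HomogeneousIdeal.toIdeal_injective ((Ideal.eq_top_iff_one _).mpr h)

open scoped Classical in
-- A larger graded left ideal contains some $r\cdot 1$ with $r\notin N$ as well as $N\cdot 1$, hence
-- $1$.
theorem isCoatom_gradedIdealOver (N : Ideal R) [hN : N.IsMaximal] :
    IsCoatom (gradedIdealOver f N) := by
  refine ⟨gradedIdealOver_ne_top hN.ne_top, fun Q hQ => eq_top_of_one_mem ?_⟩
  obtain ⟨a, haQ, ha⟩ := SetLike.exists_of_lt hQ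
  rw [mem_gradedIdealOver, not_forall] at ha
  obtain ⟨σ, hσ⟩ := ha
  obtain ⟨r, n, hn, h⟩ := hN.exists_inv hσ
  have h1 := smul_one_mem_of_mem haQ σ
  rw [← one_smul R (1 : CrossedProduct f), ← h, add_smul, mul_smul, ← smul_one_mul r]
  exact Q.toIdeal.add_mem (Q.toIdeal.mul_mem_left _ h1) (hQ.le (smul_one_mem_gradedIdealOver hn))

open scoped Classical in
theorem exists_eq_gradedIdealOver {Q : HomogeneousIdeal (component f)} (hQ : IsCoatom Q) :
    ∃ N : Ideal R, N.IsMaximal ∧ Q = gradedIdealOver f N := by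
  -- The degree-one part of $Q$; any maximal $N$ above it serves.
  let Q₁ : Ideal R :=
    { carrier := {r | r • (1 : CrossedProduct f) ∈ Q.toIdeal}
      zero_mem' := by simp
      add_mem' := fun ha hb => by
        simpa only [Set.mem_ofPred_eq, add_smul] using Q.toIdeal.add_mem ha hb
      smul_mem' := fun c r hr => by
        simp only [Set.mem_ofPred_eq, smul_eq_mul, mul_smul] at hr ⊢
        rw [← smul_one_mul c]
        exact Q.toIdeal.mul_mem_left _ hr }
  have h1 : Q₁ ≠ ⊤ := fun h => hQ.1 (eq_top_of_one_mem (by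
    have h2 : (1 : R) ∈ Q₁ := h ▸ Submodule.mem_top
    have h3 : (1 : R) • (1 : CrossedProduct f) ∈ Q.toIdeal := h2
    rwa [one_smul] at h3))
  obtain ⟨N, hN, hle⟩ := Ideal.exists_le_maximal Q₁ h1
  have hQN : Q ≤ gradedIdealOver f N := fun a ha σ => hle (smul_one_mem_of_mem ha σ)
  exact ⟨N, hN, ((hQ.le_iff.mp hQN).resolve_left (gradedIdealOver_ne_top hN.ne_top)).symm⟩

theorem mem_gradedRadical_iff {a : CrossedProduct f} :
    a ∈ gradedRadical f ↔ ∀ σ, a.coeff σ ∈ cocycleIdeal f σ := by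
  have h1 : a ∈ gradedRadical f ↔ ∀ N : Ideal R, N.IsMaximal → a ∈ gradedIdealOver f N := by
    simp only [gradedRadical, gradedJacobson, HomogeneousIdeal.toIdeal_sInf, Submodule.mem_iInf]
    refine ⟨fun h N hN => h _ (isCoatom_gradedIdealOver N), fun h Q hQ => ?_⟩
    obtain ⟨N, hN, rfl⟩ := exists_eq_gradedIdealOver hQ
    exact h N hN
  simp only [h1, mem_gradedIdealOver, mem_cocycleIdeal_iff, ← smul_val_self_inv, ← smul_mul']
  -- What remains is to remove $\sigma^{-1}$ from $\sigma^{-1}(a_\sigma f(\sigma,\sigma^{-1}))\in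
  -- N$; this is possible because $N$ runs over all maximal ideals, which $G$ permutes.
  refine ⟨fun h σ N hN => ?_, fun h N hN σ => smul_mem_of_forall_isMaximal (h σ) _ N hN⟩
  simpa using smul_mem_of_forall_isMaximal (fun N hN => h N hN σ) σ N hN

/-! ### The graded radical lies in the Jacobson radical -/

/-- Nakayama for the finite left $R$-module $A_f$: the left ideal generated by $1+u$ is everything
modulo the Jacobson radical of $R$. -/
theorem exists_mul_one_add_eq_one {u : CrossedProduct f}
    (hu : ∀ σ, u.coeff σ ∈ Ring.jacobson R) : ∃ z, z * (1 + u) = 1 := by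
  have hle : (⊤ : Submodule R (CrossedProduct f)) ≤
      (Ideal.span {1 + u}).restrictScalars R ⊔
        Ring.jacobson R • (⊤ : Submodule R (CrossedProduct f)) := by
    intro c _
    have hc : c = c * (1 + u) + -(c * u) := by rw [mul_add, mul_one]; abel
    rw [hc]
    refine Submodule.add_mem_sup (Ideal.mem_span_singleton'.mpr ⟨c, rfl⟩) (neg_mem ?_)
    rw [← sum_coeff_smul_x (c * u)]
    refine Submodule.sum_mem _ fun ρ _ => Submodule.smul_mem_smul ?_ Submodule.mem_top
    rw [coeff_mul]
    refine Ideal.sum_mem _ fun σ _ => Ideal.mul_mem_right _ _ (Ideal.mul_mem_left _ _ ?_)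
    rw [Ring.jacobson_eq_sInf_isMaximal] at hu ⊢
    simp only [Submodule.mem_sInf, Set.mem_ofPred_eq] at hu ⊢
    exact smul_mem_of_forall_isMaximal (hu _) σ
  have h := Submodule.le_of_le_smul_of_le_jacobson_bot Module.Finite.fg_top
    (Ideal.jacobson_bot (R := R)).ge hle (Submodule.mem_top (x := (1 : CrossedProduct f)))
  exact Ideal.mem_span_singleton'.mp h

open scoped Classical in
/-- The number of `ρ` with `f(σ, σ⁻¹ρ) ∉ N`. -/
noncomputable def height (f : NormalizedCocycle G R) (N : Ideal R) (σ : G) : ℕ :=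
  (Finset.univ.filter fun ρ => f.val σ (σ⁻¹ * ρ) ∉ N).card

theorem height_pos (N : Ideal R) (hN : N ≠ ⊤) (σ : G) : 0 < height f N σ :=
  Finset.card_pos.mpr ⟨σ, by simpa [f.one_right] using fun h => hN ((Ideal.eq_top_iff_one N).mpr h)⟩

open scoped Classical in
-- The height counts the elements above $\sigma$ in the preorder $f(\sigma,\sigma^{-1}\rho)\notin
-- N$. Transitivity is the cocycle identity. If also $\rho\le\sigma$, the identity with
-- $\tau=\sigma^{-1}\rho$ would give $\sigma(f(\tau,\tau^{-1}))\notin N$, contrary to the choice of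
-- $r$.
theorem height_lt (N : Ideal R) (hN : N.IsMaximal) {σ ρ : G} (h : f.val σ (σ⁻¹ * ρ) ∉ N)
    {r : R} (hr : r ∈ cocycleIdeal f (σ⁻¹ * ρ)) (hrN : σ • r ∉ N) :
    height f N ρ < height f N σ := by
  refine Finset.card_lt_card ⟨fun γ hγ => ?_, fun hsub => ?_⟩
  · simp only [Finset.mem_filter, Finset.mem_univ, true_and] at hγ ⊢
    have hc := f.cocycle σ (σ⁻¹ * ρ) (ρ⁻¹ * γ)
    simp only [mul_inv_cancel_left, mul_assoc] at hc
    intro hmem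
    refine (hN.isPrime.mem_or_mem (?_ : f.val ρ (ρ⁻¹ * γ) * f.val σ (σ⁻¹ * ρ) ∈ N)).elim hγ h
    rw [hc]
    exact N.mul_mem_left _ hmem
  · have hσ : f.val ρ (ρ⁻¹ * σ) ∉ N := by
      have := hsub (Finset.mem_filter.mpr ⟨Finset.mem_univ σ, by
        simpa [f.one_right] using fun h => hN.ne_top ((Ideal.eq_top_iff_one N).mpr h)⟩)
      exact (Finset.mem_filter.mp this).2
    have hc := f.cocycle σ (σ⁻¹ * ρ) (σ⁻¹ * ρ)⁻¹
    have h2 := smul_mem_of_forall_isMaximal (mem_cocycleIdeal_iff.mp hr) σ N hN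
    rw [mul_inv_cancel, f.one_right, mul_one] at hc
    simp only [mul_inv_cancel_left, mul_inv_rev, inv_inv, smul_mul'] at hc h2
    rw [← hc] at h2
    exact ((hN.isPrime.mem_or_mem h2).resolve_left hrN |> hN.isPrime.mem_or_mem).elim hσ h

theorem coeff_pow_mem {a : CrossedProduct f} (ha : ∀ σ, a.coeff σ ∈ cocycleIdeal f σ)
    (N : Ideal R) (hN : N.IsMaximal) (ρ : G) : (a ^ Fintype.card G).coeff ρ ∈ N := by
  -- A nonzero contribution modulo $N$ traces a strictly ascending chain, each factor costing one
  -- unit of height. At $k=|G|$ the height would be zero, although $\rho$ itself is always counted.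
  have key : ∀ (k : ℕ) (ρ : G), (a ^ k).coeff ρ ∉ N → height f N ρ + k ≤ Fintype.card G := by
    intro k
    induction k with
    | zero => exact fun ρ _ => Finset.card_le_univ _
    | succ k ih =>
      intro ρ hρ
      rw [pow_succ, coeff_mul] at hρ
      obtain ⟨σ, hσ⟩ : ∃ σ, (a ^ k).coeff σ * σ • a.coeff (σ⁻¹ * ρ) * f.val σ (σ⁻¹ * ρ) ∉ N := by
        by_contra! h
        exact hρ (N.sum_mem fun σ _ => h σ)
      have h1 := ih σ fun h => hσ (N.mul_mem_right _ (N.mul_mem_right _ h))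
      have h2 := height_lt N hN (fun h => hσ (N.mul_mem_left _ h)) (ha (σ⁻¹ * ρ))
        fun h => hσ (N.mul_mem_right _ (N.mul_mem_left _ h))
      lia
  by_contra h
  have := key _ ρ h
  have := height_pos (f := f) N hN.ne_top ρ
  lia

theorem gradedRadical_le_jacobson (f : NormalizedCocycle G R) :
    gradedRadical f ≤ Ring.jacobson (CrossedProduct f) := by
  intro a ha
  rw [← Ideal.jacobson_bot, Ideal.mem_jacobson_iff]
  intro y
  have hb := mem_gradedRadical_iff.mp ((gradedRadical f).mul_mem_left y ha)
  set b := y * a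
  -- $1-(-b)^n=\bigl(\sum_{i<n}(-b)^i\bigr)(1+b)$, so a left inverse of the left side gives one of
  -- $1+b$.
  obtain ⟨z, hz⟩ := exists_mul_one_add_eq_one (u := -(-b) ^ Fintype.card G) (fun σ => by
    rw [Ring.jacobson_eq_sInf_isMaximal]
    simp only [Submodule.mem_sInf, Set.mem_ofPred_eq, coeff_neg, neg_mem_iff]
    exact fun N hN => coeff_pow_mem (fun σ => by simpa using hb σ) N hN σ)
  refine ⟨z * ∑ i ∈ Finset.range (Fintype.card G), (-b) ^ i, ?_⟩
  rw [← sub_eq_add_neg, ← geom_sum_mul_neg, sub_neg_eq_add, ← mul_assoc, mul_add, mul_one] at hz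
  rw [mul_assoc _ y a, Ideal.mem_bot, sub_eq_zero, add_comm]
  exact hz

end CrossedProduct

/-! ### The Jacobson radical in finite-dimensional representations -/

/-- Write the minimal polynomial of $\Psi(a)$ as $X^m q$ with $q(0)\ne0$. Up to the scalar $q(0)$,
$q(\Psi(a))$ is the image of $1+ya$ for some $y\in A$, hence left invertible, and $\Psi(a)^m=0$
follows. -/
theorem isNilpotent_map_of_mem_jacobson {A B κ : Type*} [Ring A] [Field κ] [Ring B] [Algebra κ B]
    [Module.Finite κ B] (Ψ : A →+* B) (hΨ : ∀ c : κ, algebraMap κ B c ∈ Ψ.range)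
    {a : A} (ha : a ∈ Ring.jacobson A) : IsNilpotent (Ψ a) := by
  nontriviality B
  have hint : IsIntegral κ (Ψ a) := Algebra.IsIntegral.isIntegral _
  obtain ⟨q, hq, hdvd⟩ := Polynomial.exists_eq_pow_rootMultiplicity_mul_and_not_dvd
    (minpoly κ (Ψ a)) (minpoly.ne_zero hint) 0
  rw [map_zero, sub_zero, Polynomial.X_dvd_iff] at hdvd
  rw [map_zero, sub_zero] at hq
  set m := (minpoly κ (Ψ a)).rootMultiplicity 0
  -- The range contains the scalars, so polynomials in $\Psi(a)$ over $\kappa$ lift to $A$.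
  let T : Subalgebra κ B := { Ψ.range with algebraMap_mem' := hΨ }
  obtain ⟨w, hw⟩ : Polynomial.aeval (Ψ a) q.divX ∈ Ψ.range :=
    Algebra.adjoin_le (S := T) (Set.singleton_subset_iff.mpr ⟨a, rfl⟩)
      (Polynomial.aeval_mem_adjoin_singleton κ (Ψ a))
  obtain ⟨d, hd⟩ := hΨ (q.coeff 0)⁻¹
  rw [← Ideal.jacobson_bot, Ideal.mem_jacobson_iff] at ha
  obtain ⟨z, hz⟩ := ha (d * w)
  have hq' : Polynomial.aeval (Ψ a) q = Ψ w * Ψ a + algebraMap κ B (q.coeff 0) := by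
    conv_lhs => rw [← Polynomial.divX_mul_X_add q]
    simp [hw]
  have h0 : (Ψ w * Ψ a + algebraMap κ B (q.coeff 0)) * Ψ a ^ m = 0 := by
    have := minpoly.aeval κ (Ψ a)
    rw [hq, mul_comm, map_mul, map_pow, Polynomial.aeval_X, hq'] at this
    exact this
  refine ⟨m, ?_⟩
  have hz' : Ψ z * (Ψ d * (Ψ w * Ψ a + algebraMap κ B (q.coeff 0))) = 1 := by
    have h1 : Ψ d * algebraMap κ B (q.coeff 0) = 1 := by
      rw [hd, ← map_mul, inv_mul_cancel₀ hdvd, map_one]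
    rw [mul_add, h1, ← map_one Ψ, ← map_mul, ← map_mul, ← map_add, ← map_mul]
    congr 1
    rw [Ideal.mem_bot, sub_eq_zero] at hz
    rw [mul_add, mul_one]
    simpa only [mul_assoc] using hz
  calc Ψ a ^ m = Ψ z * (Ψ d * (Ψ w * Ψ a + algebraMap κ B (q.coeff 0))) * Ψ a ^ m := by
        rw [hz', one_mul]
    _ = 0 := by rw [mul_assoc, mul_assoc, h0, mul_zero, mul_zero]

/-! ### Inertia groups and independence of characters -/

open Pointwise in
-- The stabilizer modulo inertia is $\mathrm{Gal}(k/\kappa)$; the extension is always normal, and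
-- separability makes it Galois. Arbitrary models $\kappa,k$ of the quotients are allowed so that
-- residue fields of localizations fit.
theorem card_stabilizer_eq_card_inertia_mul_finrank_of_surjective {V S κ k G : Type*} [CommRing V]
    [CommRing S] [Algebra V S] [Group G] [Finite G] [MulSemiringAction G S] [SMulCommClass G V S]
    [Algebra.IsInvariant V S G] (p : Ideal V) [p.IsMaximal] (M : Ideal S) [M.IsMaximal]
    [M.LiesOver p] [Field κ] [Field k] [Algebra κ k] [Module.Finite κ k] [Algebra.IsSeparable κ k]
    (φ : V →+* κ) (hφ : Function.Surjective φ) (hφp : RingHom.ker φ = p)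
    (π : S →+* k) (hπ : Function.Surjective π) (hπM : RingHom.ker π = M)
    (h : ∀ v, algebraMap κ k (φ v) = π (algebraMap V S v)) :
    Nat.card (MulAction.stabilizer G M) =
      Nat.card (M.toAddSubgroup.inertia G) * Module.finrank κ k := by
  let _ := Ideal.Quotient.field p
  let _ := Ideal.Quotient.field M
  let : Algebra (V ⧸ p) κ := (Ideal.Quotient.lift p φ fun v hv => by rwa [← hφp] at hv).toAlgebra
  let : Algebra (S ⧸ M) k := (Ideal.Quotient.lift M π fun v hv => by rwa [← hπM] at hv).toAlgebra
  have : IsFractionRing (V ⧸ p) κ := .of_field _ _ fun z => by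
    obtain ⟨v, rfl⟩ := hφ z
    exact ⟨Ideal.Quotient.mk p v, 1, by rw [map_one, div_one]; rfl⟩
  have : IsFractionRing (S ⧸ M) k := .of_field _ _ fun z => by
    obtain ⟨v, rfl⟩ := hπ z
    exact ⟨Ideal.Quotient.mk M v, 1, by rw [map_one, div_one]; rfl⟩
  let : Algebra (V ⧸ p) k :=
    ((algebraMap (S ⧸ M) k).comp (algebraMap (V ⧸ p) (S ⧸ M))).toAlgebra
  have : IsScalarTower (V ⧸ p) (S ⧸ M) k := .of_algebraMap_eq' rfl
  have : IsScalarTower (V ⧸ p) κ k := .of_algebraMap_eq' (by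
    ext v
    exact (h v).symm)
  have : IsGalois κ k := { __ := Ideal.IsFractionRing.normal G p M κ k }
  have hidx : (M.toAddSubgroup.inertia (MulAction.stabilizer G M)).index = Nat.card Gal(k/κ) :=
    Nat.card_congr (IsFractionRing.stabilizerQuotientInertiaEquiv G p M κ k).toEquiv
  rw [← IsGalois.card_aut_eq_finrank, ← hidx,
    ← ((M.toAddSubgroup.inertia G).subgroupOf (MulAction.stabilizer G M)).card_mul_index,
    Nat.card_congr (Subgroup.subgroupOfEquivOfLe (Ideal.inertia_le_stabilizer (M := G) M)).toEquiv,
    AddSubgroup.subgroupOf_inertia]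

/-- If the order of the inertia group of `ker π` is invertible and the trace of `s c` vanishes
modulo `ker π` for every `s`, then all conjugates of `c` lie in `ker π`: this is the independence of
the characters `s ↦ π (ρ s)`. -/
theorem map_smul_eq_zero_of_sum_eq_zero {G S k : Type*} [Group G] [Fintype G] [CommRing S]
    [MulSemiringAction G S] [Field k] (π : S →+* k)
    (hI : (Nat.card ((RingHom.ker π).toAddSubgroup.inertia G) : k) ≠ 0) {c : S}
    (hc : ∀ s : S, ∑ ρ : G, π (ρ • (s * c)) = 0) (ρ : G) : π (ρ • c) = 0 := by
  classical
  let χ : G → S →* k := fun ρ => (π : S →* k).comp (MulDistribMulAction.toMonoidHom S ρ)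
  have hχ : ∀ ρ s, χ ρ s = π (ρ • s) := fun _ _ => rfl
  -- $\chi_\rho=\chi_{\rho_0}$ exactly when $\rho\rho_0^{-1}$ is in the inertia group.
  have hfib : ∀ ρ₀ : G, (Finset.univ.filter fun ρ => χ ρ = χ ρ₀).card =
      Nat.card ((RingHom.ker π).toAddSubgroup.inertia G) := by
    intro ρ₀
    rw [← Fintype.card_subtype, ← Nat.card_eq_fintype_card]
    refine (Nat.card_congr ((Equiv.mulRight ρ₀).subtypeEquiv fun g => ?_)).symm
    simp only [AddSubgroup.mem_inertia, Submodule.mem_toAddSubgroup, RingHom.mem_ker, map_sub,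
      sub_eq_zero, MonoidHom.ext_iff, hχ, Equiv.coe_mulRight, mul_smul]
    exact ⟨fun h s => h _, fun h s => by simpa using h (ρ₀⁻¹ • s)⟩
  have hsum : ∑ ψ ∈ Finset.univ.image χ,
      ((Nat.card ((RingHom.ker π).toAddSubgroup.inertia G) : k) * ψ c) • (ψ : S → k) = 0 := by
    ext s
    rw [Finset.sum_apply, Pi.zero_apply, ← hc s,
      ← Finset.sum_fiberwise_of_maps_to (fun ρ _ => Finset.mem_image_of_mem χ (Finset.mem_univ ρ))]
    refine Finset.sum_congr rfl fun ψ hψ => ?_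
    obtain ⟨ρ₀, -, rfl⟩ := Finset.mem_image.mp hψ
    rw [Finset.sum_congr rfl (g := fun _ => χ ρ₀ s * χ ρ₀ c), Finset.sum_const, hfib]
    · simp only [Pi.smul_apply, smul_eq_mul, nsmul_eq_mul]; ring
    · intro ρ hρ
      rw [← (Finset.mem_filter.mp hρ).2, smul_mul', map_mul, hχ, hχ]
  have := linearIndependent_iff'.mp (linearIndependent_monoidHom S k) _ _ hsum (χ ρ)
    (Finset.mem_image_of_mem χ (Finset.mem_univ ρ))
  exact (mul_eq_zero.mp this).resolve_left hI

/-! ### The Jacobson radical lies in the graded radical -/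

namespace CrossedProduct

variable {G V S κ k : Type*} [Group G] [Fintype G] [CommRing V] [CommRing S] [Algebra V S]
  [MulSemiringAction G S] [SMulCommClass G V S] [Field κ] [Field k] [Algebra κ k]
  [Module.Finite κ k] [Algebra V κ]

theorem map_smul_coeff_one_eq_zero {f : NormalizedCocycle G S} (π : S →+* k)
    (hV : Function.Surjective (algebraMap V κ))
    (hπ : ∀ v : V, π (algebraMap V S v) = algebraMap κ k (algebraMap V κ v))
    (hI : (Nat.card ((RingHom.ker π).toAddSubgroup.inertia G) : k) ≠ 0)
    {a : CrossedProduct f} (ha : a ∈ Ring.jacobson (CrossedProduct f)) (ρ : G) :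
    π (ρ • a.coeff 1) = 0 := by
  classical
  refine map_smul_eq_zero_of_sum_eq_zero π hI (fun s => ?_) ρ
  let Ψ : CrossedProduct f →+* Matrix G G k := π.mapMatrix.comp (toMatrix f)
  -- Elements of $V$ are fixed by $G$, so they act by scalar matrices.
  have hΨ : ∀ c : κ, algebraMap κ (Matrix G G k) c ∈ Ψ.range := by
    intro c
    obtain ⟨v, rfl⟩ := hV c
    refine ⟨algebraMap V S v • 1, ?_⟩
    ext σ τ
    simp only [Ψ, RingHom.comp_apply, toMatrix_smul_one, smul_algebraMap, RingHom.mapMatrix_apply,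
      Matrix.map_apply, Matrix.algebraMap_matrix_apply, Matrix.diagonal_apply, apply_ite π, hπ,
      map_zero]
  have hs : s • a ∈ Ring.jacobson (CrossedProduct f) := by
    rw [← smul_one_mul s a]
    exact Ideal.mul_mem_left _ _ ha
  have := (Matrix.isNilpotent_trace_of_isNilpotent
    (isNilpotent_map_of_mem_jacobson (κ := κ) Ψ hΨ hs)).eq_zero
  rwa [RingHom.comp_apply, RingHom.mapMatrix_apply, ← AddMonoidHom.map_trace, trace_toMatrix,
    map_sum] at this

theorem jacobson_le_gradedRadical {G S : Type*} [Group G] [Fintype G] [CommRing S]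
    [MulSemiringAction G S] {f : NormalizedCocycle G S}
    (h : ∀ a ∈ Ring.jacobson (CrossedProduct f), ∀ N : Ideal S, N.IsMaximal → a.coeff 1 ∈ N) :
    Ring.jacobson (CrossedProduct f) ≤ gradedRadical f := by
  intro a ha
  refine mem_gradedRadical_iff.mpr fun σ => mem_cocycleIdeal_iff.mpr fun N hN => ?_
  rw [← coeff_mul_x, mul_inv_cancel]
  exact h _ (Ideal.IsTwoSided.mul_mem_of_left _ ha) N hN

end CrossedProduct

/-! ### Ramification in the integral closure -/

section IntegralClosure

open Pointwise IsLocalRing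

theorem isInvariant_integralClosure (V F K : Type*) [CommRing V] [IsDomain V] [IsIntegrallyClosed V]
    [Field F] [Algebra V F] [IsFractionRing V F] [Field K] [Algebra F K] [FiniteDimensional F K]
    [IsGalois F K] [Algebra V K] [IsScalarTower V F K] :
    Algebra.IsInvariant V (integralClosure V K) (K ≃ₐ[F] K) where
  isInvariant b hb := by
    have hb' : (b : K) ∈ Set.range (algebraMap F K) :=
      (IsGalois.mem_range_algebraMap_iff_fixed _).mpr fun σ => congrArg Subtype.val (hb σ)
    obtain ⟨y, hy⟩ := hb'
    have hint : IsIntegral V y :=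
      (isIntegral_algebraMap_iff (FaithfulSMul.algebraMap_injective F K)).mp (hy ▸ b.2)
    obtain ⟨v, rfl⟩ := IsIntegrallyClosed.algebraMap_eq_of_integral hint
    exact ⟨v, Subtype.ext (by rw [← hy, ← IsScalarTower.algebraMap_apply]; rfl)⟩

theorem residue_localization_surjective {S : Type*} [CommRing S] (M : Ideal S) [M.IsMaximal] :
    Function.Surjective (algebraMap S (ResidueField (Localization.AtPrime M))) := by
  intro z
  obtain ⟨w, rfl⟩ := M.bijective_algebraMap_quotient_residueField.2 z
  obtain ⟨s, rfl⟩ := Ideal.Quotient.mk_surjective w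
  exact ⟨s, rfl⟩

variable {V F K : Type*} [CommRing V] [IsLocalRing V] [Field F] [Algebra V F] [Field K]
  [Algebra F K] [FiniteDimensional F K] [Algebra V K] [IsScalarTower V F K]

/-- `Module.finrank` is $0$ for an infinite extension, which would force $[K:F]=0$. -/
theorem IsDefectless.finite_residueField {M : Ideal (integralClosure V K)} [M.IsMaximal]
    (hd : IsDefectless F M) :
    Module.Finite (ResidueField V) (ResidueField (Localization.AtPrime M)) := by
  refine FiniteDimensional.of_finrank_pos (Nat.pos_of_ne_zero fun h => ?_)
  have : 0 < Module.finrank F K := Module.finrank_pos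
  rw [hd, h] at this
  simp at this

instance maximalIdeal_liesOver (M : Ideal (integralClosure V K)) [M.IsMaximal] :
    M.LiesOver (maximalIdeal V) :=
  ⟨(IsLocalRing.eq_maximalIdeal (Ideal.isMaximal_comap_of_isIntegral_of_isMaximal M)).symm⟩

theorem card_maximalSpectrum_integralClosure
    [Algebra.IsInvariant V (integralClosure V K) (K ≃ₐ[F] K)]
    (M : Ideal (integralClosure V K)) [M.IsMaximal] :
    Nat.card (MaximalSpectrum (integralClosure V K)) =
      Nat.card (MulAction.orbit (K ≃ₐ[F] K) M) := by
  rw [Algebra.IsInvariant.orbit_eq_primesOver V _ (K ≃ₐ[F] K) (maximalIdeal V) M]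
  refine Nat.card_congr ⟨fun N => ⟨N.1, have := N.2; ⟨inferInstance, inferInstance⟩⟩,
    fun N => ⟨N.1, ?_⟩, fun _ => rfl, fun _ => rfl⟩
  have := N.2.1
  have := N.2.2
  exact Ideal.isMaximal_of_isIntegral_of_isMaximal_comap (R := V) N.1
    (by rw [← Ideal.under_def, ← N.2.2.over]; infer_instance)

/-- Orbit–stabilizer gives $[K:F]=r\,|I|\,[\overline S_M:\overline V]$, where $I$ is the inertia
group; compare with $[K:F]=e\,[\overline S_M:\overline V]\,r$ and cancel. -/
theorem card_inertia_eq_ramificationIndex [IsGalois F K]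
       [Algebra.IsInvariant V (integralClosure V K) (K ≃ₐ[F] K)]
    (M : Ideal (integralClosure V K)) [M.IsMaximal]
    (hsep : Algebra.IsSeparable (ResidueField V) (ResidueField (Localization.AtPrime M)))
    (hd : IsDefectless F M) :
    Nat.card (M.toAddSubgroup.inertia (K ≃ₐ[F] K)) = ramificationIndex F M := by
  have := hd.finite_residueField
  have hstab := card_stabilizer_eq_card_inertia_mul_finrank_of_surjective (G := K ≃ₐ[F] K)
    (maximalIdeal V) M (residue V) residue_surjective ker_residue
    (algebraMap _ (ResidueField (Localization.AtPrime M))) (residue_localization_surjective M)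
    M.ker_algebraMap_residueField fun v => rfl
  have hG : Nat.card (MulAction.orbit (K ≃ₐ[F] K) M) *
      Nat.card (MulAction.stabilizer (K ≃ₐ[F] K) M) = Module.finrank F K := by
    rw [← IsGalois.card_aut_eq_finrank F K, ← Nat.card_prod]
    exact Nat.card_congr (MulAction.orbitProdStabilizerEquivGroup _ M)
  have hpos : 0 < Module.finrank F K := Module.finrank_pos
  rw [hd, card_maximalSpectrum_integralClosure (F := F) M, mul_assoc] at hG hpos
  rw [hstab] at hG
  refine Nat.eq_of_mul_eq_mul_right (Nat.pos_of_mul_pos_left hpos) ?_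
  rw [← hG]
  ring

theorem card_inertia_ne_zero [IsGalois F K]
    [Algebra.IsInvariant V (integralClosure V K) (K ≃ₐ[F] K)]
    (M : Ideal (integralClosure V K)) [M.IsMaximal]
    (ht : IsTamelyRamified F M) (hd : IsDefectless F M) :
    (Nat.card (M.toAddSubgroup.inertia (K ≃ₐ[F] K)) : ResidueField (Localization.AtPrime M)) ≠
      0 := by
  rw [card_inertia_eq_ramificationIndex M ht.2 hd, ← map_natCast (algebraMap (ResidueField V) _),
    map_ne_zero, Ne, ringChar.spec]
  exact ht.1

/-- Hypotheses at the single ideal $M$ suffice: every $N$ is some $\sigma M$, and all conjugates of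
$a_1$ lie in $M$. -/
theorem coeff_one_mem_of_mem_jacobson [IsGalois F K]
    [Algebra.IsInvariant V (integralClosure V K) (K ≃ₐ[F] K)]
    {f : NormalizedCocycle (K ≃ₐ[F] K) (integralClosure V K)}
    (M : Ideal (integralClosure V K)) [M.IsMaximal]
    (ht : IsTamelyRamified F M) (hd : IsDefectless F M) {a : CrossedProduct f}
    (ha : a ∈ Ring.jacobson (CrossedProduct f)) (N : Ideal (integralClosure V K))
    (hN : N.IsMaximal) : a.coeff 1 ∈ N := by
  have := hd.finite_residueField
  obtain ⟨σ, rfl⟩ := Algebra.IsInvariant.exists_smul_of_under_eq V _ (K ≃ₐ[F] K) M N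
    ((Ideal.over_def M (maximalIdeal V)).symm.trans (Ideal.over_def N (maximalIdeal V)))
  rw [Ideal.mem_pointwise_smul_iff_inv_smul_mem, ← M.ker_algebraMap_residueField, RingHom.mem_ker]
  exact CrossedProduct.map_smul_coeff_one_eq_zero (κ := ResidueField V)
    (algebraMap (integralClosure V K) (ResidueField (Localization.AtPrime M)))
    residue_surjective (fun v => rfl)
    (by rw [M.ker_algebraMap_residueField]; exact card_inertia_ne_zero M ht hd) ha _

end IntegralClosure

theorem theorem3p1 {V F K : Type*}
    [CommRing V] [IsDomain V] [ValuationRing V]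
    [Field F] [Algebra V F] [IsFractionRing V F]
    [Field K] [Algebra F K] [FiniteDimensional F K] [IsGalois F K]
    [Algebra V K] [IsScalarTower V F K]
    (f : (K ≃ₐ[F] K) × (K ≃ₐ[F] K) → Kˣ)
    (hf : groupCohomology.IsMulCocycle₂ f)
    (hnorm : ∀ σ : K ≃ₐ[F] K, f (1, σ) = 1 ∧ f (σ, 1) = 1)
    (hint : ∀ σ τ : K ≃ₐ[F] K, (f (σ, τ) : K) ∈ integralClosure V K)
    (M : Ideal (integralClosure V K)) [M.IsMaximal]
    (htame : IsTamelyRamified F M) (hdefectless : IsDefectless F M) :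
    Ring.jacobson (CrossedProduct (integralCocycle f hf hnorm hint)) =
        CrossedProduct.gradedRadical (integralCocycle f hf hnorm hint) ∧
      (CrossedProduct.gradedRadical (integralCocycle f hf hnorm hint) :
          Set (CrossedProduct (integralCocycle f hf hnorm hint))) =
        {a | ∃ s : (K ≃ₐ[F] K) → integralClosure V K,
          (∀ σ, s σ ∈ cocycleIdeal (integralCocycle f hf hnorm hint) σ) ∧
          a = ∑ σ, s σ • CrossedProduct.x (integralCocycle f hf hnorm hint) σ} := by
  have := isInvariant_integralClosure V F K
  refine ⟨le_antisymm (CrossedProduct.jacobson_le_gradedRadical fun a ha N hN =>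
    coeff_one_mem_of_mem_jacobson M htame hdefectless ha N hN)
    (CrossedProduct.gradedRadical_le_jacobson _), Set.ext fun a => ?_⟩
  refine CrossedProduct.mem_gradedRadical_iff.trans
    ⟨fun h => ⟨a.coeff, h, (CrossedProduct.sum_coeff_smul_x a).symm⟩, ?_⟩
  rintro ⟨s, hs, rfl⟩
  rwa [show ∑ σ, s σ • CrossedProduct.x (integralCocycle f hf hnorm hint) σ = ⟨s⟩ from
    CrossedProduct.sum_coeff_smul_x ⟨s⟩]
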